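/- **Theorem (Min-cut Max-flow Theorem).** Let $G$ be an ADT network: a finite set $\mathcal V$ of supernodes, where each $V\in\mathcal V$ has a finite set $I(V)$ of input ports and a finite set $O(V)$ of output ports, together with a set $\mathcal E$ of edges $(e,e')$ from output ports $e$ to input ports $e'$. Assume that $G$ is acyclic, i.e. the directed graph on $\mathcal V$ with an arc $V_1\to V_2$ whenever some edge goes from $O(V_1)$ to $I(V_2)$ has no directed cycle. Let $\mathbb F_q$ be a finite field, let $S\neq T$ be supernodes, and let $c$ be a single unicast connection from $S$ to $T$ of rate $R=R(c)\in\mathbb N$, i.e. $S$ has $R$ source processes $X(S,1),\dots,X(S,R)$, all of which $T$ has to reproduce. *Transmission.* Given coding variables $\alpha_{(i,e)},\beta_{(e',e)},\epsilon_{(e',(T,k))}\in\mathbb F_q$, the symbols at the ports satisfy, for $e\in O(V)$ and every input port $e'$, $$Y(e)=\sum_{e'\in I(V)}\beta_{(e',e)}Y(e')+[V=S]\sum_{i=1}^R\alpha_{(i,e)}X(S,i),\qquad Y(e')=\sum_{e:\,(e,e')\in\mathcal E}Y(e),$$ and $T$ outputs $Z(T,k)=\sum_{e'\in I(T)}\epsilon_{(e',(T,k))}Y(e')$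 for $k=1,\dots,R$. The connection $c$ is *feasible* if the coding variables can be chosen in $\mathbb F_q$ such that $Z(T,k)=X(S,k)$ for all $k$, for all values of the source symbols. *Min-cut.* $mincut(S,T)=\min_\Omega \operatorname{rank}_{\mathbb F_q}(G_\Omega)$ over all $\Omega\subseteq\mathcal V$ with $S\in\Omega$, $T\notin\Omega$, where $G_\Omega$ is the $0$-$1$ incidence matrix whose rows are the output ports of supernodes in $\Omega$, whose columns are the input ports of supernodes in $\Omega^c$, and whose entry at $(e,e')$ is $1$ exactly if $(e,e')\in\mathcal E$. *System matrix.* $M=A(I-F)^{-1}B^T$. Here $F$ is indexed by all ports, with $F_{e,e'}=1$ if $(e,e')\in\mathcal E$, $F_{e',e}=\beta_{(e',e)}$ if $e'\in I(V)$ and $e\in O(V)$ for the same supernode $V$, and all other entries $0$; $A$ is $R\times\{\text{ports}\}$ with $A_{i,e}=\alpha_{(i,e)}$ for $e\in O(S)$ and $0$ otherwise; $B$ is $R\times\{\text{ports}\}$ with $B_{k,e'}=\epsilon_{(e',(T,k))}$ for $e'\in I(T)$ and $0$ otherwise. Then the following are equivalent: 1. the connection $c$ is feasible; 2. $mincut(S,T)\ge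 R(c)$; 3. there is an assignment of values in $\mathbb F_q$ to the variables $\alpha,\beta,\epsilon$ such that the $R(c)\times R(c)$ system matrix $M$ is invertible over $\mathbb F_q$. -/

import Mathlib

/-- An ADT network with supernode set `V`, input ports `I` and output ports `O`.  Every port belongs
to one supernode, and a (unit capacity) edge leads from an output port to an input port.  An output
port broadcasts its symbol on all its edges; the symbols that arrive at an input port are added. -/
structure ADTNetwork (V I O : Type*) where
  /-- the supernode that an input port belongs to -/
  inNode : I → V
  /-- the supernode that an output port belongs to -/
  outNode : O → V
  /-- the edge set -/
  edge : O → I → Prop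

/-- The free coding variables for a connection of rate `R` over the field `K`. -/
structure CodingVariables (I O K : Type*) (R : ℕ) where
  /-- `α i e`: coefficient of the source process `X(S, i)` at the output port `e` of the source -/
  α : Fin R → O → K
  /-- `β e' e`: coefficient of the input port `e'` at the output port `e` of the same supernode -/
  β : I → O → K
  /-- `ε e' k`: coefficient of the input port `e'` of the destination in the process `Z(T, k)` -/
  ε : I → Fin R → K

namespace ADTNetwork

variable {V I O : Type*}

/-- There is an edge from an output port of the supernode `u` to an input port of `v`. -/
def Link (N : ADTNetwork V I O) (u v : V) : Prop :=
  ∃ o i, N.outNode o = u ∧ N.inNode i = v ∧ N.edge o i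

/-- The directed graph on the supernodes has no directed cycle. -/
def Acyclic (N : ADTNetwork V I O) : Prop :=
  ∀ v, ¬ Relation.TransGen N.Link v v

/-! ### Transmission of symbols, and feasibility of a unicast connection -/

open Classical in
/-- The symbols `Yout`, `Yin` at the output and input ports are those produced by the source
symbols `X` at the supernode `S` under the coding variables `κ`. -/
structure IsTransmission [Fintype I] [Fintype O] {K : Type*} [Field K] {R : ℕ}
    (N : ADTNetwork V I O) (S : V) (κ : CodingVariables I O K R)
    (X : Fin R → K) (Yout : O → K) (Yin : I → K) : Prop where
  /-- an output port of a supernode other than the source -/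
  relay : ∀ e, N.outNode e ≠ S →
    Yout e = ∑ e' with N.inNode e' = N.outNode e, κ.β e' e * Yin e'
  /-- an output port of the source -/
  source : ∀ e, N.outNode e = S →
    Yout e = (∑ e' with N.inNode e' = N.outNode e, κ.β e' e * Yin e') + ∑ i, κ.α i e * X i
  /-- broadcast and superposition -/
  input : ∀ e', Yin e' = ∑ e with N.edge e e', Yout e

open Classical in
/-- The processes `Z(T, k)` that the destination `T` computes from its input ports. -/
noncomputable def output [Fintype I] {K : Type*} [Field K] {R : ℕ}
    (N : ADTNetwork V I O) (T : V) (κ : CodingVariables I O K R) (Yin : I → K) : Fin R → K :=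
  fun k => ∑ e' with N.inNode e' = T, κ.ε e' k * Yin e'

/-- The coding variables `κ` establish the connection of rate `R` from `S` to `T`: whatever the
source symbols are, the network carries them, and the destination reproduces them. -/
def Establishes [Fintype I] [Fintype O] {K : Type*} [Field K] {R : ℕ}
    (N : ADTNetwork V I O) (S T : V) (κ : CodingVariables I O K R) : Prop :=
  ∀ X : Fin R → K,
    (∃ Yout Yin, N.IsTransmission S κ X Yout Yin) ∧
    ∀ Yout Yin, N.IsTransmission S κ X Yout Yin → N.output T κ Yin = X

/-- The unicast connection of rate `R` from `S` to `T` is feasible over `K`. -/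
def Feasible [Fintype I] [Fintype O] (K : Type*) [Field K]
    (N : ADTNetwork V I O) (S T : V) (R : ℕ) : Prop :=
  ∃ κ : CodingVariables I O K R, N.Establishes S T κ

/-! ### Minimal cut -/

open Classical in
/-- The incidence matrix of the cut `Ω`: rows are the output ports in `Ω`, columns are the input
ports in the complement of `Ω`. -/
noncomputable def cutMatrix (K : Type*) [Field K] (N : ADTNetwork V I O) (Ω : Set V) :
    Matrix {e : O // N.outNode e ∈ Ω} {e' : I // N.inNode e' ∉ Ω} K :=
  fun e e' => if N.edge e.1 e'.1 then 1 else 0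

open Classical in
/-- The minimal rank over `K` of the incidence matrix of a cut `Ω` with `S ∈ Ω` and `T ∉ Ω`
(such cuts exist as soon as `S ≠ T`). -/
noncomputable def minCut [Fintype I] (K : Type*) [Field K]
    (N : ADTNetwork V I O) (S T : V) : ℕ :=
  sInf {r | ∃ Ω : Set V, S ∈ Ω ∧ T ∉ Ω ∧ (N.cutMatrix K Ω).rank = r}

/-! ### The system matrix -/

open Classical in
/-- The adjacency matrix `F`, indexed by all ports. -/
noncomputable def adjacencyMatrix {K : Type*} [Field K] {R : ℕ}
    (N : ADTNetwork V I O) (κ : CodingVariables I O K R) : Matrix (O ⊕ I) (O ⊕ I) K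
  | Sum.inl e, Sum.inr e' => if N.edge e e' then 1 else 0
  | Sum.inr e', Sum.inl e => if N.inNode e' = N.outNode e then κ.β e' e else 0
  | _, _ => 0

open Classical in
/-- The encoding matrix `A`. -/
noncomputable def encodingMatrix {K : Type*} [Field K] {R : ℕ}
    (N : ADTNetwork V I O) (S : V) (κ : CodingVariables I O K R) : Matrix (Fin R) (O ⊕ I) K
  | i, Sum.inl e => if N.outNode e = S then κ.α i e else 0
  | _, Sum.inr _ => 0

open Classical in
/-- The decoding matrix `B`, with one row for each process `Z(T, k)`. -/
noncomputable def decodingMatrix {K : Type*} [Field K] {R : ℕ}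
    (N : ADTNetwork V I O) (T : V) (κ : CodingVariables I O K R) : Matrix (Fin R) (O ⊕ I) K
  | _, Sum.inl _ => 0
  | k, Sum.inr e' => if N.inNode e' = T then κ.ε e' k else 0

open Classical in
/-- The system matrix `M = A (1 - F)⁻¹ Bᵀ`. -/
noncomputable def systemMatrix [Fintype I] [Fintype O] {K : Type*} [Field K] {R : ℕ}
    (N : ADTNetwork V I O) (S T : V) (κ : CodingVariables I O K R) :
    Matrix (Fin R) (Fin R) K :=
  N.encodingMatrix S κ * (1 - N.adjacencyMatrix κ)⁻¹ * (N.decodingMatrix T κ).transpose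

end ADTNetwork

/-! ### Linear algebra: ranks of matrices -/

namespace Matrix

variable {m n j k L : Type*} [Fintype m] [Fintype n] [Fintype j] [Fintype k] [Field L]

/-! Acyclicity grades the ports, so `1 - F` is invertible, the transmission is unique and `T`
outputs `X * M`. Feasibility thus means `M = 1`, and an invertible `M` becomes `1` after precoding
by `M⁻¹` at the source. If a combination of source symbols vanishes across a cut, everything beyond
the cut is zero, so a feasible rate is at most the rank of every cut.

For the converse, work over the algebraic closure and eliminate the nodes other than `S` and `T` one
at a time (`exists_transfer_of_le_rank_cut`). Giving `v` the transfer matrix `β` replaces `E` by `E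
+ E * β * E`. A cut block `P` turns into `P + Q * β * W`, where `[P Q]` and `[P; W]` are the old
cuts with `v` on the sink side and on the source side. As both have rank at least `r`, some `β`
keeps rank `r` (`exists_le_rank_add_mul_mul`); over an infinite field one `β` serves all cuts. When
only `S` and `T` remain, the `S`-`T` block has rank at least `r`, which yields encoder and decoder.

To return to the base field, border `1 - F` by `A` and `Bᵀ`: the determinant is that of `M` up to a
unit, and each coding variable has an entry of its own. The determinant is affine in each entry, so
the variables can be moved one by one to `0` or `±1`, which lie in every field. -/

theorem exists_mul_mul_eq_one_of_le_rank (A : Matrix m n L) {r : ℕ} (h : r ≤ A.rank) :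
    ∃ (U : Matrix (Fin r) m L) (W : Matrix n (Fin r) L), U * A * W = 1 := by
  classical
  let b := Module.finBasis L (LinearMap.range A.mulVecLin)
  have hb : LinearIndependent L fun i : Fin r => (b (Fin.castLE h i) : m → L) :=
    (b.linearIndependent.comp _ (Fin.castLE_injective h)).map' (Submodule.subtype _)
      (Submodule.ker_subtype _)
  choose w hw using fun i : Fin r => (b (Fin.castLE h i)).2
  let W : Matrix n (Fin r) L := of fun a i => w i a
  have hAW : (A * W).col = fun i : Fin r => (b (Fin.castLE h i) : m → L) := by
    funext i
    rw [← hw i]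
    ext a
    simp [W, mul_apply, mulVec, dotProduct]
  have hinj : Function.Injective (A * W).mulVecLin := by
    rw [coe_mulVecLin, mulVec_injective_iff, hAW]
    exact hb
  obtain ⟨g, hg⟩ := (A * W).mulVecLin.exists_leftInverse_of_injective
    (LinearMap.ker_eq_bot.2 hinj)
  refine ⟨LinearMap.toMatrix' g, W, ?_⟩
  have := congrArg LinearMap.toMatrix' hg
  rw [LinearMap.toMatrix'_comp, LinearMap.toMatrix'_id] at this
  rw [Matrix.mul_assoc, ← this]
  congr 1
  exact (LinearMap.toMatrix'_toLin' _).symm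

theorem le_rank_of_mul_mul_eq_one {A : Matrix m n L} {r : ℕ} {U : Matrix (Fin r) m L}
    {W : Matrix n (Fin r) L} (h : U * A * W = 1) : r ≤ A.rank := by
  have h1 : (U * A * W).rank = r := by rw [h, rank_one, Fintype.card_fin]
  calc r = (U * A * W).rank := h1.symm
    _ ≤ (U * A).rank := rank_mul_le_left _ _
    _ ≤ A.rank := rank_mul_le_right _ _

/-- The rank is lower semicontinuous along a line. -/
theorem finite_setOf_not_le_rank_add_smul (A B : Matrix m n L) {r : ℕ} (h : r ≤ A.rank) :
    {t : L | ¬ r ≤ (A + t • B).rank}.Finite := by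
  classical
  obtain ⟨U, W, hUW⟩ := exists_mul_mul_eq_one_of_le_rank A h
  -- Since `U * A * W = 1`, this is `det (U * (A + t • B) * W)` as a polynomial in `t`. It is `1` at
  -- `t = 0`, and the rank can drop below `r` only at its roots.
  let p : Polynomial L := det (1 + (Polynomial.X : Polynomial L) • (U * B * W).map Polynomial.C)
  have hp : ∀ t : L, p.eval t = det (U * (A + t • B) * W) := by
    intro t
    rw [Matrix.mul_add, Matrix.add_mul, hUW, Matrix.mul_smul, Matrix.smul_mul]
    simp only [p]
    rw [← Polynomial.coe_evalRingHom, RingHom.map_det]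
    congr 1
    ext a b
    by_cases hab : a = b <;> simp [hab, -Matrix.map_mul, mul_comm t]
  have hp0 : p ≠ 0 := by
    intro h0
    have := hp 0
    simp [h0, hUW] at this
  refine (p.roots.toFinset.finite_toSet).subset fun t ht => ?_
  rw [Finset.mem_coe, Multiset.mem_toFinset, Polynomial.mem_roots hp0, Polynomial.IsRoot, hp]
  by_contra hdet
  apply ht
  have hunit : IsUnit (U * (A + t • B) * W) :=
    (isUnit_iff_isUnit_det _).2 (isUnit_iff_ne_zero.2 hdet)
  have h1 : (U * (A + t • B) * W).rank = r := by rw [rank_of_isUnit _ hunit, Fintype.card_fin]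
  calc r = (U * (A + t • B) * W).rank := h1.symm
    _ ≤ (U * (A + t • B)).rank := rank_mul_le_left _ _
    _ ≤ (A + t • B).rank := rank_mul_le_right _ _

/-- Over an infinite field, finitely many rank conditions on a matrix that can be satisfied
separately can be satisfied simultaneously. -/
theorem exists_forall_le_rank_add_mul_mul [Infinite L] {ι : Type*} (s : Finset ι) (r : ℕ)
    (P : ι → Matrix m n L) (Q : ι → Matrix m j L) (W : ι → Matrix k n L)
    (h : ∀ a ∈ s, ∃ β : Matrix j k L, r ≤ (P a + Q a * β * W a).rank) :
    ∃ β : Matrix j k L, ∀ a ∈ s, r ≤ (P a + Q a * β * W a).rank := by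
  classical
  induction s using Finset.induction_on with
  | empty => exact ⟨0, by simp⟩
  | insert c s hc ih =>
    obtain ⟨β₀, h₀⟩ := ih fun a ha => h a (Finset.mem_insert_of_mem ha)
    obtain ⟨β₁, h₁⟩ := h c (Finset.mem_insert_self _ _)
    -- On the line from `β₀` to `β₁`, the conditions in `s` hold at `t = 0` and that for `c` at `t =
    -- 1`; each excludes only finitely many `t`.
    have e0 : ∀ a (t : L), P a + Q a * (β₀ + t • (β₁ - β₀)) * W a
        = (P a + Q a * β₀ * W a) + t • (Q a * (β₁ - β₀) * W a) := by
      intro a t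
      simp only [Matrix.mul_add, Matrix.add_mul, Matrix.mul_smul, Matrix.smul_mul, add_assoc]
    have e1 : ∀ a (t : L), P a + Q a * (β₀ + t • (β₁ - β₀)) * W a
        = (P a + Q a * β₁ * W a) + (t - 1) • (Q a * (β₁ - β₀) * W a) := by
      intro a t
      rw [e0, sub_smul, one_smul, Matrix.mul_sub, Matrix.sub_mul]
      abel
    have f0 : (⋃ a ∈ s, {t : L | ¬ r ≤ (P a + Q a * (β₀ + t • (β₁ - β₀)) * W a).rank}).Finite := by
      refine Set.Finite.biUnion s.finite_toSet fun a ha => ?_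
      simp only [e0]
      exact finite_setOf_not_le_rank_add_smul _ _ (h₀ a ha)
    have f1 : {t : L | ¬ r ≤ (P c + Q c * (β₀ + t • (β₁ - β₀)) * W c).rank}.Finite := by
      simp only [e1]
      exact (finite_setOf_not_le_rank_add_smul _ (Q c * (β₁ - β₀) * W c) h₁).preimage
        (sub_left_injective (b := (1 : L))).injOn
    obtain ⟨t, ht⟩ := (f0.union f1).exists_notMem
    simp only [Set.mem_union, Set.mem_iUnion, Set.mem_ofPred_eq, not_or, not_exists, not_not] at ht
    refine ⟨β₀ + t • (β₁ - β₀), fun a ha => ?_⟩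
    rcases Finset.mem_insert.1 ha with rfl | ha
    · exact ht.2
    · exact ht.1 a ha

omit [Fintype m] in
-- Choose `Q u` outside the range of `P`, and `v` in the kernel of `P` with `(W v) b ≠ 0`. A
-- rank-one `β` adds `(W x) b • Q u` to `P x`; this cannot cancel `P x` unless it is zero, so the
-- kernel only shrinks, and it loses `v`.
theorem exists_rank_lt_rank_add_mul_mul (P : Matrix m n L) (Q : Matrix m j L) (W : Matrix k n L)
    (hQ : ¬ LinearMap.range Q.mulVecLin ≤ LinearMap.range P.mulVecLin)
    (hW : ¬ LinearMap.ker P.mulVecLin ≤ LinearMap.ker W.mulVecLin) :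
    ∃ β : Matrix j k L, P.rank < (P + Q * β * W).rank := by
  classical
  obtain ⟨_, ⟨u, rfl⟩, hu⟩ := SetLike.not_le_iff_exists.1 hQ
  obtain ⟨v, hv, hWv⟩ := SetLike.not_le_iff_exists.1 hW
  have hWv' : W *ᵥ v ≠ 0 := hWv
  obtain ⟨b, hb⟩ := Function.ne_iff.1 hWv'
  let β : Matrix j k L := vecMulVec u (Pi.single b 1)
  have hmul : ∀ x, (P + Q * β * W) *ᵥ x = P *ᵥ x + (W *ᵥ x) b • Q *ᵥ u := by
    intro x
    rw [add_mulVec, ← mulVec_mulVec, ← mulVec_mulVec]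
    congr 1
    rw [← mulVec_smul]
    congr 1
    ext a
    simp [β, vecMulVec_apply, mulVec, dotProduct, Pi.single_apply, mul_comm]
  have hker : LinearMap.ker (P + Q * β * W).mulVecLin < LinearMap.ker P.mulVecLin := by
    have key : ∀ x, (P + Q * β * W) *ᵥ x = 0 → (W *ᵥ x) b = 0 ∧ P *ᵥ x = 0 := by
      intro x hx
      rw [hmul] at hx
      have h0 : (W *ᵥ x) b = 0 := by
        by_contra hne
        apply hu
        refine ⟨-((W *ᵥ x) b)⁻¹ • x, ?_⟩
        rw [mulVecLin_apply, mulVec_smul, eq_neg_of_add_eq_zero_left hx, smul_neg, neg_smul,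
          neg_neg, smul_smul, inv_mul_cancel₀ hne, one_smul]
        rfl
      rw [h0, zero_smul, add_zero] at hx
      exact ⟨h0, hx⟩
    refine SetLike.lt_iff_le_and_exists.2 ⟨fun x hx => (key x hx).2, v, hv, fun hmem => ?_⟩
    exact hb (key v hmem).1
  refine ⟨β, ?_⟩
  have h1 := (P + Q * β * W).mulVecLin.finrank_range_add_finrank_ker
  have h2 := P.mulVecLin.finrank_range_add_finrank_ker
  have h3 := Submodule.finrank_lt_finrank_of_lt hker
  simp only [rank]
  omega

omit [Fintype m] in
/-- The completion `P + Q * β * W` attains every rank allowed by the columns of `[P Q]` and by the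
rows of `[P; W]`. -/
theorem exists_le_rank_add_mul_mul (P : Matrix m n L) (Q : Matrix m j L) (W : Matrix k n L) {r : ℕ}
    (hQ : r ≤ Module.finrank L
      (LinearMap.range P.mulVecLin ⊔ LinearMap.range Q.mulVecLin : Submodule L (m → L)))
    (hW : r + Module.finrank L
      (LinearMap.ker P.mulVecLin ⊓ LinearMap.ker W.mulVecLin : Submodule L (n → L))
        ≤ Fintype.card n) :
    ∃ β : Matrix j k L, r ≤ (P + Q * β * W).rank := by
  -- The rank is raised one unit at a time: while it is below `r`, dimension counting excludes that
  -- the range contains that of `Q`, or that the kernel lies in that of `W`.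
  suffices H : ∀ s ≤ r, ∃ β : Matrix j k L, s ≤ (P + Q * β * W).rank from H r le_rfl
  intro s
  induction s with
  | zero => exact fun _ => ⟨0, Nat.zero_le _⟩
  | succ s ih =>
    intro hs
    obtain ⟨β, hβ⟩ := ih (by omega)
    by_cases hlt : s + 1 ≤ (P + Q * β * W).rank
    · exact ⟨β, hlt⟩
    have hmul : ∀ x, (P + Q * β * W) *ᵥ x = P *ᵥ x + Q *ᵥ (β *ᵥ (W *ᵥ x)) := by
      intro x
      rw [add_mulVec, ← mulVec_mulVec, ← mulVec_mulVec]
    obtain ⟨γ, hγ⟩ := exists_rank_lt_rank_add_mul_mul (P + Q * β * W) Q W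
      (fun hle => by
        have : LinearMap.range P.mulVecLin ⊔ LinearMap.range Q.mulVecLin
            ≤ LinearMap.range (P + Q * β * W).mulVecLin := by
          refine sup_le ?_ hle
          rintro _ ⟨x, rfl⟩
          have : P.mulVecLin x = (P + Q * β * W).mulVecLin x - Q.mulVecLin (β *ᵥ (W *ᵥ x)) := by
            simp only [mulVecLin_apply, hmul, add_sub_cancel_right]
          rw [this]
          exact Submodule.sub_mem _ ⟨x, rfl⟩ (hle ⟨_, rfl⟩)
        have := Submodule.finrank_mono this
        simp only [rank] at hlt
        omega)
      (fun hle => by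
        have : LinearMap.ker (P + Q * β * W).mulVecLin
            ≤ LinearMap.ker P.mulVecLin ⊓ LinearMap.ker W.mulVecLin := by
          refine le_inf (fun x hx => ?_) hle
          have h1 : (P + Q * β * W) *ᵥ x = 0 := hx
          have h2 : W *ᵥ x = 0 := hle hx
          rw [hmul, h2, mulVec_zero, mulVec_zero, add_zero] at h1
          exact h1
        have h3 := Submodule.finrank_mono this
        have h4 := (P + Q * β * W).mulVecLin.finrank_range_add_finrank_ker
        rw [Module.finrank_fintype_fun_eq_card] at h4
        simp only [rank] at hlt
        omega)
    refine ⟨β + γ, ?_⟩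
    have : P + Q * (β + γ) * W = P + Q * β * W + Q * γ * W := by
      rw [Matrix.mul_add, Matrix.add_mul, add_assoc]
    rw [this]
    omega

/-- The determinant is affine in each entry. -/
theorem det_add_smul_single {R : Type*} [CommRing R] [DecidableEq n] (A : Matrix n n R) (a b : n)
    (t : R) : (A + t • single a b 1).det = A.det + t * (A.updateRow a (Pi.single b 1)).det := by
  have : A + t • single a b (1 : R) = A.updateRow a (A a + t • Pi.single b 1) := by
    ext c d
    rcases eq_or_ne c a with rfl | hc
    · rcases eq_or_ne d b with rfl | hd
      · simp
      · simp [hd, hd.symm]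
    · simp [hc, hc.symm]
  rw [this, det_updateRow_add, det_updateRow_smul, updateRow_eq_self]

/-- In a nonsingular matrix any set of entries may be replaced by zeros and ones, in such a way
that the matrix stays nonsingular. -/
theorem exists_det_ne_zero_entry_zero_or_one [DecidableEq n] (A : Matrix n n L) (hA : A.det ≠ 0)
    (s : Finset (n × n)) :
    ∃ A' : Matrix n n L, A'.det ≠ 0 ∧ (∀ p ∉ s, A' p.1 p.2 = A p.1 p.2) ∧
      ∀ p ∈ s, A' p.1 p.2 = 0 ∨ A' p.1 p.2 = 1 := by
  induction s using Finset.induction_on with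
  | empty => exact ⟨A, hA, by simp, by simp⟩
  | insert c s hc ih =>
    obtain ⟨A', hdet, hout, hin⟩ := ih
    obtain ⟨a, b⟩ := c
    have hent : ∀ (t : L) (p : n × n), p ≠ (a, b) →
        (A' + t • single a b (1 : L)) p.1 p.2 = A' p.1 p.2 := by
      intro t p hp
      have : ¬ (a = p.1 ∧ b = p.2) := fun h => hp (Prod.ext h.1.symm h.2.symm)
      simp [this]
    -- An affine function of the entry that vanishes at both `0` and `1` vanishes identically, hence
    -- also at the current value.
    have hex : ∃ x : L, (x = 0 ∨ x = 1) ∧ (A' + (x - A' a b) • single a b (1 : L)).det ≠ 0 := by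
      by_contra! H
      have h0 := H 0 (Or.inl rfl)
      have h1 := H 1 (Or.inr rfl)
      rw [det_add_smul_single] at h0 h1
      have h2 : (A'.updateRow a (Pi.single b 1)).det = 0 := by linear_combination h1 - h0
      rw [h2, mul_zero, add_zero] at h0
      exact hdet h0
    obtain ⟨x, hx, hne⟩ := hex
    refine ⟨_, hne, fun p hp => ?_, fun p hp => ?_⟩
    · rw [Finset.mem_insert, not_or] at hp
      rw [hent _ _ hp.1, hout p hp.2]
    · rcases eq_or_ne p (a, b) with rfl | hpne
      · simpa using hx
      · rw [hent _ _ hpne]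
        exact hin p ((Finset.mem_insert.1 hp).resolve_left hpne)

end Matrix

/-! ### Elimination of the intermediate nodes -/

namespace Matrix

section coordProj

variable {m n L : Type*} [Fintype m] [Fintype n] [Field L]

open Classical in
/-- The diagonal matrix that projects onto the coordinates in `x`. -/
noncomputable def coordProj (L : Type*) [Field L] (x : Set n) : Matrix n n L :=
  diagonal (x.indicator 1)

omit [Fintype n] in
theorem coordProj_union {x y : Set n} (h : Disjoint x y) :
    coordProj L (x ∪ y) = coordProj L x + coordProj L y := by
  classical
  rw [coordProj, coordProj, coordProj, diagonal_add, Set.indicator_union_of_disjoint h]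

theorem coordProj_mul_mul_coordProj_apply (x : Set m) (A : Matrix m n L) (y : Set n) (a : m)
    (b : n) :
    (coordProj L x * A * coordProj L y) a b = x.indicator 1 a * A a b * y.indicator 1 b := by
  classical
  rw [coordProj, coordProj, mul_diagonal, diagonal_mul]

theorem coordProj_mul_mul_coordProj_ne_zero {x : Set m} {A : Matrix m n L} {y : Set n} {a : m}
    {b : n} (h : (coordProj L x * A * coordProj L y) a b ≠ 0) : a ∈ x ∧ b ∈ y := by
  rw [coordProj_mul_mul_coordProj_apply] at h
  exact ⟨Set.mem_of_indicator_ne_zero (left_ne_zero_of_mul (left_ne_zero_of_mul h)),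
    Set.mem_of_indicator_ne_zero (right_ne_zero_of_mul h)⟩

/-- If the block of `E` with rows `x` and columns `y` keeps rank `r` both when the columns `p` and
when the rows `q` are added, then it can be completed through `p` and `q` to rank `r`. -/
theorem exists_le_rank_block_completion (E : Matrix m n L) {x q : Set m} {y p : Set n}
    (hxq : Disjoint x q) (hyp : Disjoint y p) {r : ℕ}
    (hp : r ≤ (coordProj L x * E * coordProj L (y ∪ p)).rank)
    (hq : r ≤ (coordProj L (x ∪ q) * E * coordProj L y).rank) :
    ∃ β : Matrix n m L, r ≤ (coordProj L x * E * coordProj L y +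
      (coordProj L x * E * coordProj L p) * β * (coordProj L q * E * coordProj L y)).rank := by
  apply exists_le_rank_add_mul_mul
  · refine hp.trans (Submodule.finrank_mono ?_)
    rw [coordProj_union hyp, Matrix.mul_add, mulVecLin_add]
    rintro _ ⟨v, rfl⟩
    exact Submodule.add_mem_sup ⟨v, rfl⟩ ⟨v, rfl⟩
  · have h1 := (coordProj L (x ∪ q) * E * coordProj L y).mulVecLin.finrank_range_add_finrank_ker
    rw [Module.finrank_fintype_fun_eq_card] at h1
    have h2 : LinearMap.ker (coordProj L x * E * coordProj L y).mulVecLin ⊓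
        LinearMap.ker (coordProj L q * E * coordProj L y).mulVecLin ≤
        LinearMap.ker (coordProj L (x ∪ q) * E * coordProj L y).mulVecLin := by
      rintro v ⟨hv1, hv2⟩
      rw [coordProj_union hxq, Matrix.add_mul, Matrix.add_mul, mulVecLin_add, LinearMap.mem_ker,
        LinearMap.add_apply, LinearMap.mem_ker.1 hv1, LinearMap.mem_ker.1 hv2, add_zero]
    have h3 := Submodule.finrank_mono h2
    simp only [rank] at hq
    omega

end coordProj

variable {V I O L : Type*} [Fintype I] [Fintype O] [Field L]

theorem exists_mul_mul_ne_zero {A : Matrix O I L} {B : Matrix I O L} {C : Matrix O I L} {o : O}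
    {i : I} (h : (A * B * C) o i ≠ 0) :
    ∃ i' o', A o i' ≠ 0 ∧ B i' o' ≠ 0 ∧ C o' i ≠ 0 := by
  rw [mul_apply] at h
  obtain ⟨o', -, ho'⟩ := Finset.exists_ne_zero_of_sum_ne_zero h
  have h1 := left_ne_zero_of_mul ho'
  rw [mul_apply] at h1
  obtain ⟨i', -, hi'⟩ := Finset.exists_ne_zero_of_sum_ne_zero h1
  exact ⟨i', o', left_ne_zero_of_mul hi', right_ne_zero_of_mul hi', right_ne_zero_of_mul ho'⟩

open Classical in
/-- **Max-flow min-cut over an infinite field.**  `E` is a linear network on the ports `O` and `I`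
of the nodes `U`, `S`, `T`, graded by `ht`.  If all cuts have rank at least `r`, then the nodes in
`U` can be given transfer matrices, with the block diagonal sum `B`, such that the resulting
transfer matrix `G` from `S` to `T` has rank at least `r`. -/
theorem exists_transfer_of_le_rank_cut [Infinite L] (out : O → V) (inn : I → V) (ht : V → ℕ)
    {S T : V} {r : ℕ} (U : Finset V) (hS : S ∉ U) (hT : T ∉ U) (E : Matrix O I L)
    (hE : ∀ o i, E o i ≠ 0 → ht (out o) < ht (inn i))
    (hcut : ∀ a ⊆ U, r ≤ (coordProj L (out ⁻¹' (insert S a : Finset V)) * E *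
      coordProj L (inn ⁻¹' (insert T (U \ a) : Finset V))).rank) :
    ∃ (B : Matrix I O L) (G : Matrix O I L), (∀ i o, B i o ≠ 0 → inn i = out o) ∧
      G = E + E * B * G ∧
      r ≤ (coordProj L (out ⁻¹' {S}) * G * coordProj L (inn ⁻¹' {T})).rank := by
  induction U using Finset.induction_on generalizing E with
  | empty =>
    refine ⟨0, E, by simp, by simp, ?_⟩
    simpa using hcut ∅ (Finset.Subset.refl _)
  | insert v U hv ih =>
    rw [Finset.mem_insert, not_or] at hS hT
    let p : Set I := inn ⁻¹' {v}
    let q : Set O := out ⁻¹' {v}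
    let x : Finset V → Set O := fun a => out ⁻¹' (insert S a : Finset V)
    let y : Finset V → Set I := fun a => inn ⁻¹' (insert T (U \ a) : Finset V)
    obtain ⟨β', hβ'⟩ := exists_forall_le_rank_add_mul_mul U.powerset r
      (fun a => coordProj L (x a) * E * coordProj L (y a))
      (fun a => coordProj L (x a) * E * coordProj L p)
      (fun a => coordProj L q * E * coordProj L (y a)) (by
        intro a ha
        rw [Finset.mem_powerset] at ha
        have hva : v ∉ a := fun h => hv (ha h)
        apply exists_le_rank_block_completion
        · rw [Set.disjoint_left]
          intro o ho hoq
          have h1 : out o = v := hoq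
          have h2 : out o ∈ insert S a := ho
          rw [h1, Finset.mem_insert] at h2
          exact h2.elim (fun h => hS.1 h.symm) hva
        · rw [Set.disjoint_left]
          intro i hi hip
          have h1 : inn i = v := hip
          have h2 : inn i ∈ insert T (U \ a) := hi
          rw [h1, Finset.mem_insert, Finset.mem_sdiff] at h2
          exact h2.elim (fun h => hT.1 h.symm) fun h => hv h.1
        -- The cut with `v` on the side of `T`.
        · convert hcut a (ha.trans (Finset.subset_insert _ _)) using 4
          ext i
          have : inn i = v → inn i ∉ a := fun h => h ▸ hva
          simp only [y, p, Set.mem_union, Set.mem_preimage, Finset.mem_coe, Finset.mem_insert,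
            Finset.mem_sdiff, Set.mem_singleton_iff]
          tauto
        -- The cut with `v` on the side of `S`.
        · convert hcut (insert v a) (Finset.insert_subset_insert _ ha) using 4
          · congr 1
            ext o
            simp only [x, q, Set.mem_union, Set.mem_preimage, Finset.mem_coe, Finset.mem_insert,
              Set.mem_singleton_iff]
            tauto
          · ext i
            have : inn i ∈ U → inn i ≠ v := fun h h' => hv (h' ▸ h)
            simp only [y, Set.mem_preimage, Finset.mem_coe, Finset.mem_insert, Finset.mem_sdiff]
            tauto)
    let β : Matrix I O L := coordProj L p * β' * coordProj L q
    have hβ : ∀ i o, β i o ≠ 0 → inn i = v ∧ out o = v := fun i o h =>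
      coordProj_mul_mul_coordProj_ne_zero (x := p) (A := β') (y := q) h
    -- Edges raise the height, so none leads from `v` back to `v`.
    have hββ : β * E * β = 0 := by
      ext i o
      by_contra h
      obtain ⟨o', i', h1, h2, h3⟩ := exists_mul_mul_ne_zero h
      have := hE _ _ h2
      rw [(hβ _ _ h1).2, (hβ _ _ h3).1] at this
      exact lt_irrefl _ this
    obtain ⟨B, G, hB, hG, hr⟩ := ih hS.2 hT.2 (E + E * β * E)
      (by
        intro o i h
        by_cases h0 : E o i = 0
        · rw [add_apply, h0, zero_add] at h
          obtain ⟨i', o', h1, h2, h3⟩ := exists_mul_mul_ne_zero h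
          have e1 := hE _ _ h1
          have e3 := hE _ _ h3
          rw [(hβ _ _ h2).1] at e1
          rw [(hβ _ _ h2).2] at e3
          exact e1.trans e3
        · exact hE _ _ h0)
      (by
        intro a ha
        convert hβ' a (Finset.mem_powerset.2 ha) using 2
        simp only [β, x, y, Matrix.mul_add, Matrix.add_mul, Matrix.mul_assoc])
    refine ⟨β + B, G, fun i o h => ?_, ?_, hr⟩
    · by_cases h0 : β i o = 0
      · rw [add_apply, h0, zero_add] at h
        exact hB _ _ h
      · exact (hβ _ _ h0).1.trans (hβ _ _ h0).2.symm
    -- A path passes through `v` at most once: the terms containing `β * E * β` drop out.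
    · have h1 : β * G = β * (E + E * B * G) := by
        conv_lhs => rw [hG]
        simp only [Matrix.mul_add, Matrix.add_mul, ← Matrix.mul_assoc, hββ, Matrix.zero_mul,
          add_zero]
      calc G = (E + E * B * G) + E * (β * (E + E * B * G)) := by
            conv_lhs => rw [hG]
            simp only [Matrix.mul_add, Matrix.add_mul, Matrix.mul_assoc]
            abel
        _ = E + E * (β + B) * G := by
            rw [← h1]
            simp only [Matrix.mul_add, Matrix.add_mul, Matrix.mul_assoc]
            abel

end Matrix

/-! ### The system matrix of an acyclic network -/

open Matrix in
-- A row vector fixed by `F` is zero by induction on the grade, as each coordinate depends only on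
-- coordinates of smaller grade.
theorem Matrix.isUnit_one_sub_of_graded {p K : Type*} [Fintype p] [DecidableEq p] [Field K]
    (F : Matrix p p K) (ht : p → ℕ) (hF : ∀ a b, F a b ≠ 0 → ht a < ht b) : IsUnit (1 - F) := by
  rw [← vecMul_injective_iff_isUnit]
  intro y z hyz
  have h0 : (y - z) ᵥ* F = y - z := by
    have : (y - z) ᵥ* (1 - F) = 0 := by rw [sub_vecMul]; exact sub_eq_zero.2 hyz
    rw [vecMul_sub, vecMul_one] at this
    exact (sub_eq_zero.1 this).symm
  have key : ∀ n b, ht b = n → (y - z) b = 0 := by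
    intro n
    induction n using Nat.strong_induction_on with
    | _ n ih =>
      intro b hb
      rw [← h0]
      refine Finset.sum_eq_zero fun a _ => ?_
      change (y - z) a * F a b = 0
      by_cases hab : F a b = 0
      · rw [hab, mul_zero]
      · rw [ih _ (hb ▸ hF a b hab) a rfl, zero_mul]
  exact sub_eq_zero.1 (funext fun b => key _ b rfl)

namespace ADTNetwork

open Matrix

variable {V I O : Type*}

theorem Acyclic.exists_height [Finite V] {N : ADTNetwork V I O} (hN : N.Acyclic) :
    ∃ ht : V → ℕ, ∀ o i, N.edge o i → ht (N.outNode o) < ht (N.inNode i) := by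
  -- The height is the number of strict ancestors. Along a link, the tail's ancestors are inherited
  -- by the head, and the tail itself is added.
  refine ⟨fun v => Set.ncard {u | Relation.TransGen N.Link u v}, fun o i hoi => ?_⟩
  have hl : N.Link (N.outNode o) (N.inNode i) := ⟨o, i, rfl, rfl, hoi⟩
  exact Set.ncard_lt_ncard ⟨fun u hu => Relation.TransGen.tail hu hl,
    fun h => hN _ (h (Relation.TransGen.single hl))⟩ (Set.toFinite _)

section

variable {K : Type*} [Field K] {R : ℕ}

open Classical in
/-- The `0`-`1` matrix of the edge set. -/
noncomputable def edgeMatrix (K : Type*) [Field K] (N : ADTNetwork V I O) : Matrix O I K :=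
  of fun e e' => if N.edge e e' then 1 else 0

open Classical in
theorem isUnit_one_sub_adjacencyMatrix [Finite V] [Fintype I] [Fintype O] {N : ADTNetwork V I O}
    (hN : N.Acyclic) (κ : CodingVariables I O K R) : IsUnit (1 - N.adjacencyMatrix κ) := by
  obtain ⟨ht, hht⟩ := hN.exists_height
  refine isUnit_one_sub_of_graded _
    -- Doubling leaves room to place the output ports of a node just after its input ports.
    (Sum.elim (fun e => 2 * ht (N.outNode e) + 1) fun e' => 2 * ht (N.inNode e')) ?_
  rintro (e | e') (o | i) h
  · exact absurd rfl h
  · have : N.edge e i := by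
      by_contra hne
      exact h (if_neg hne)
    have := hht _ _ this
    simp only [Sum.elim_inl, Sum.elim_inr]
    omega
  · have : N.inNode e' = N.outNode o := by
      by_contra hne
      exact h (if_neg hne)
    simp only [Sum.elim_inl, Sum.elim_inr, this]
    omega
  · exact absurd rfl h

theorem isTransmission_iff [Fintype I] [Fintype O] {N : ADTNetwork V I O} {S : V}
    {κ : CodingVariables I O K R} {X : Fin R → K} {Y : O ⊕ I → K} :
    N.IsTransmission S κ X (Y ∘ Sum.inl) (Y ∘ Sum.inr) ↔
      Y = Y ᵥ* N.adjacencyMatrix κ + X ᵥ* N.encodingMatrix S κ := by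
  classical
  have hl : ∀ e, (Y ᵥ* N.adjacencyMatrix κ) (Sum.inl e) =
      ∑ e' with N.inNode e' = N.outNode e, κ.β e' e * Y (Sum.inr e') := by
    intro e
    simp [vecMul, dotProduct, adjacencyMatrix, Finset.sum_filter, mul_comm]
  have hr : ∀ e', (Y ᵥ* N.adjacencyMatrix κ) (Sum.inr e') =
      ∑ e with N.edge e e', Y (Sum.inl e) := by
    intro e'
    simp [vecMul, dotProduct, adjacencyMatrix, Finset.sum_filter]
  have al : ∀ e, (X ᵥ* N.encodingMatrix S κ) (Sum.inl e) =
      if N.outNode e = S then ∑ i, κ.α i e * X i else 0 := by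
    intro e
    by_cases h : N.outNode e = S <;> simp [vecMul, dotProduct, encodingMatrix, h, mul_comm]
  have ar : ∀ e', (X ᵥ* N.encodingMatrix S κ) (Sum.inr e') = 0 := by
    intro e'
    simp [vecMul, dotProduct, encodingMatrix]
  constructor
  · intro h
    funext p
    rcases p with e | e'
    · rw [Pi.add_apply, hl, al]
      split_ifs with hS
      · exact h.source e hS
      · rw [add_zero]
        exact h.relay e hS
    · rw [Pi.add_apply, hr, ar, add_zero]
      exact h.input e'
  · intro h
    refine ⟨fun e hS => ?_, fun e hS => ?_, fun e' => ?_⟩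
    · have := congrFun h (Sum.inl e)
      rwa [Pi.add_apply, hl, al, if_neg hS, add_zero] at this
    · have := congrFun h (Sum.inl e)
      rwa [Pi.add_apply, hl, al, if_pos hS] at this
    · have := congrFun h (Sum.inr e')
      rwa [Pi.add_apply, hr, ar, add_zero] at this

theorem output_eq [Fintype I] [Fintype O] (N : ADTNetwork V I O) (T : V)
    (κ : CodingVariables I O K R) (Y : O ⊕ I → K) :
    N.output T κ (Y ∘ Sum.inr) = Y ᵥ* (N.decodingMatrix T κ)ᵀ := by
  classical
  funext k
  simp [output, vecMul, dotProduct, decodingMatrix, Finset.sum_filter, mul_comm]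

open Classical in
theorem isTransmission_iff_eq_vecMul [Finite V] [Fintype I] [Fintype O] {N : ADTNetwork V I O}
    (hN : N.Acyclic) {S : V} {κ : CodingVariables I O K R} {X : Fin R → K} {Y : O ⊕ I → K} :
    N.IsTransmission S κ X (Y ∘ Sum.inl) (Y ∘ Sum.inr) ↔
      Y = X ᵥ* (N.encodingMatrix S κ * (1 - N.adjacencyMatrix κ)⁻¹) := by
  have hu := (isUnit_iff_isUnit_det _).1 (isUnit_one_sub_adjacencyMatrix hN κ)
  rw [isTransmission_iff, ← vecMul_vecMul]
  constructor
  · intro h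
    have h1 : Y ᵥ* (1 - N.adjacencyMatrix κ) = X ᵥ* N.encodingMatrix S κ := by
      rw [vecMul_sub, vecMul_one, sub_eq_iff_eq_add']
      exact h
    rw [← h1, vecMul_vecMul, mul_nonsing_inv _ hu, vecMul_one]
  · intro h
    have h1 : Y ᵥ* (1 - N.adjacencyMatrix κ) = X ᵥ* N.encodingMatrix S κ := by
      rw [h, vecMul_vecMul, nonsing_inv_mul _ hu, vecMul_one]
    rwa [vecMul_sub, vecMul_one, sub_eq_iff_eq_add'] at h1

theorem establishes_iff [Finite V] [Fintype I] [Fintype O] {N : ADTNetwork V I O}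
    (hN : N.Acyclic) (S T : V) (κ : CodingVariables I O K R) :
    N.Establishes S T κ ↔ N.systemMatrix S T κ = 1 := by
  classical
  have hout : ∀ X Y, N.IsTransmission S κ X (Y ∘ Sum.inl) (Y ∘ Sum.inr) →
      N.output T κ (Y ∘ Sum.inr) = X ᵥ* N.systemMatrix S T κ := by
    intro X Y h
    rw [output_eq, (isTransmission_iff_eq_vecMul hN).1 h, vecMul_vecMul]
    rfl
  constructor
  · intro h
    refine ext_of_single_vecMul fun i => ?_
    obtain ⟨⟨Yo, Yi, hY⟩, h2⟩ := h (Pi.single i 1)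
    have h3 := hout _ (Sum.elim Yo Yi) hY
    rw [← h3, vecMul_one]
    exact h2 _ _ hY
  · intro h X
    refine ⟨⟨_, _, (isTransmission_iff_eq_vecMul hN).2 rfl⟩, fun Yo Yi hY => ?_⟩
    have h3 := hout _ (Sum.elim Yo Yi) hY
    rw [h, vecMul_one] at h3
    exact h3

theorem feasible_iff_exists_isUnit_systemMatrix [Finite V] [Fintype I] [Fintype O]
    {N : ADTNetwork V I O} (hN : N.Acyclic) (S T : V) :
    N.Feasible K S T R ↔ ∃ κ : CodingVariables I O K R, IsUnit (N.systemMatrix S T κ) := by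
  classical
  constructor
  · rintro ⟨κ, h⟩
    exact ⟨κ, by rw [(establishes_iff hN S T κ).1 h]; exact isUnit_one⟩
  · rintro ⟨κ, h⟩
    let C := (N.systemMatrix S T κ)⁻¹
    -- Precoding at the source changes `A` alone, so it multiplies the system matrix by `C` on the
    -- left.
    let κ' : CodingVariables I O K R := ⟨C * of κ.α, κ.β, κ.ε⟩
    refine ⟨κ', (establishes_iff hN S T κ').2 ?_⟩
    have hA : N.encodingMatrix S κ' = C * N.encodingMatrix S κ := by
      ext i p
      rcases p with e | e'
      · by_cases hS : N.outNode e = S <;> simp [encodingMatrix, κ', mul_apply, hS]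
      · simp [encodingMatrix, mul_apply]
    have hF : N.adjacencyMatrix κ' = N.adjacencyMatrix κ := by
      ext p q
      rcases p with e | e' <;> rcases q with o | i <;> rfl
    have hB : N.decodingMatrix T κ' = N.decodingMatrix T κ := by
      ext i p
      rcases p with e | e' <;> rfl
    have hM : N.systemMatrix S T κ' = C * N.systemMatrix S T κ := by
      rw [systemMatrix, systemMatrix, hA, hF, hB]
      simp only [Matrix.mul_assoc]
    rw [hM]
    exact nonsing_inv_mul _ ((isUnit_iff_isUnit_det _).1 h)

/-! ### Feasible rates are bounded by the cuts -/

open Classical in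
-- Induction on the height: beyond the cut no source symbols enter, and what arrives from `Ω` adds
-- up to zero. At equal height, input ports come before output ports.
theorem IsTransmission.eq_zero_of_cut [Finite V] [Fintype I] [Fintype O] {N : ADTNetwork V I O}
    (hN : N.Acyclic) {S : V} {κ : CodingVariables I O K R} {X : Fin R → K} {Yo : O → K}
    {Yi : I → K} (h : N.IsTransmission S κ X Yo Yi) {Ω : Set V} (hS : S ∈ Ω)
    (h0 : (fun e : {e // N.outNode e ∈ Ω} => Yo e) ᵥ* N.cutMatrix K Ω = 0) (e' : I)
    (he' : N.inNode e' ∉ Ω) : Yi e' = 0 := by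
  classical
  obtain ⟨ht, hht⟩ := hN.exists_height
  have key : ∀ n, (∀ e', N.inNode e' ∉ Ω → ht (N.inNode e') = n → Yi e' = 0) ∧
      ∀ e, N.outNode e ∉ Ω → ht (N.outNode e) = n → Yo e = 0 := by
    intro n
    induction n using Nat.strong_induction_on with
    | _ n ih =>
      have hin : ∀ e', N.inNode e' ∉ Ω → ht (N.inNode e') = n → Yi e' = 0 := by
        intro e' he' hn
        rw [h.input, Finset.sum_filter,
          ← Fintype.sum_subtype_add_sum_subtype (fun e => N.outNode e ∈ Ω)]
        have h1 := congrFun h0 ⟨e', he'⟩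
        simp only [vecMul, dotProduct, cutMatrix, mul_ite, mul_one, mul_zero,
          Pi.zero_apply] at h1
        rw [h1, zero_add]
        refine Finset.sum_eq_zero fun e _ => ?_
        split_ifs with hee'
        · exact (ih _ (hn ▸ hht _ _ hee')).2 e e.2 rfl
        · rfl
      refine ⟨hin, fun e he hn => ?_⟩
      rw [h.relay e fun hes => he (hes ▸ hS)]
      refine Finset.sum_eq_zero fun e' he' => ?_
      have := (Finset.mem_filter.1 he').2
      rw [hin e' (this ▸ he) (this ▸ hn), mul_zero]
  exact (key _).1 e' he' rfl

open Classical in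
theorem Feasible.le_rank_cutMatrix [Finite V] [Fintype I] [Fintype O] {N : ADTNetwork V I O}
    (hN : N.Acyclic) {S T : V} (h : N.Feasible K S T R) {Ω : Set V} (hS : S ∈ Ω) (hT : T ∉ Ω) :
    R ≤ (N.cutMatrix K Ω).rank := by
  classical
  obtain ⟨κ, hκ⟩ := h
  let G := N.encodingMatrix S κ * (1 - N.adjacencyMatrix κ)⁻¹
  let G' : Matrix (Fin R) {e : O // N.outNode e ∈ Ω} K := G.submatrix id fun e => Sum.inl e.1
  -- Two source vectors that agree across the cut differ by one whose transmission is zero at `T`;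
  -- since `T` reproduces it, it is zero.
  have hinj : Function.Injective (G' * N.cutMatrix K Ω).vecMul := by
    intro X X' hXX'
    have h0 : (X - X') ᵥ* (G' * N.cutMatrix K Ω) = 0 := by
      rw [sub_vecMul]
      exact sub_eq_zero.2 hXX'
    have hY : N.IsTransmission S κ (X - X') (((X - X') ᵥ* G) ∘ Sum.inl)
      (((X - X') ᵥ* G) ∘ Sum.inr) := (isTransmission_iff_eq_vecMul hN).2 rfl
    have h1 := hY.eq_zero_of_cut hN hS (by
      rw [← vecMul_vecMul] at h0
      exact h0)
    have h2 := (hκ (X - X')).2 _ _ hY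
    rw [← sub_eq_zero, ← h2]
    funext k
    refine Finset.sum_eq_zero fun e' he' => ?_
    rw [h1 e' ((Finset.mem_filter.1 he').2 ▸ hT), mul_zero]
  have hrank := (vecMul_injective_iff.1 hinj).rank_matrix
  rw [Fintype.card_fin] at hrank
  rw [← hrank]
  exact rank_mul_le_right _ _

open Classical in
theorem le_minCut_iff [Fintype I] {N : ADTNetwork V I O} {S T : V} (hST : S ≠ T) :
    R ≤ N.minCut K S T ↔ ∀ Ω : Set V, S ∈ Ω → T ∉ Ω → R ≤ (N.cutMatrix K Ω).rank := by
  constructor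
  · intro h Ω hS hT
    exact h.trans (Nat.sInf_le ⟨Ω, hS, hT, rfl⟩)
  · intro h
    -- The cut `{S}` shows that the infimum is not the default value `0` of an empty set.
    refine le_csInf ⟨_, {S}, rfl, fun hT => hST hT.symm, rfl⟩ ?_
    rintro _ ⟨Ω, hS, hT, rfl⟩
    exact h Ω hS hT

end

end ADTNetwork

/-! ### Codes that attain the minimal cut -/

namespace ADTNetwork

open Matrix

variable {V I O K L : Type*} [Field K] [Field L] {R : ℕ}

open Classical in
/-- The system matrix bordered by the encoding and decoding matrices. -/
noncomputable def borderedMatrix [Fintype I] [Fintype O] (N : ADTNetwork V I O) (S T : V)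
    (κ : CodingVariables I O K R) : Matrix ((O ⊕ I) ⊕ Fin R) ((O ⊕ I) ⊕ Fin R) K :=
  fromBlocks (1 - N.adjacencyMatrix κ) (N.decodingMatrix T κ)ᵀ (N.encodingMatrix S κ) 0

open Classical in
-- Schur complement: the bordered determinant is `det (1 - F) * det (-M)`. It avoids the inverse in
-- `M`, through which the variables would enter in higher degree.
theorem isUnit_systemMatrix_iff [Finite V] [Fintype I] [Fintype O] {N : ADTNetwork V I O}
    (hN : N.Acyclic) (S T : V) (κ : CodingVariables I O K R) :
    IsUnit (N.systemMatrix S T κ) ↔ (N.borderedMatrix S T κ).det ≠ 0 := by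
  have hu := isUnit_one_sub_adjacencyMatrix hN κ
  have hdet := ((isUnit_iff_isUnit_det _).1 hu).ne_zero
  let : Invertible (1 - N.adjacencyMatrix κ) := hu.invertible
  rw [borderedMatrix, det_fromBlocks₁₁, invOf_eq_nonsing_inv, zero_sub, det_neg]
  change _ ↔ _ * (_ * (N.systemMatrix S T κ).det) ≠ 0
  rw [isUnit_iff_isUnit_det, isUnit_iff_ne_zero]
  simp [hdet]

/-- The entries of the bordered matrix that hold coding variables. -/
def IsCodingEntry (N : ADTNetwork V I O) (S T : V) :
    (O ⊕ I) ⊕ Fin R → (O ⊕ I) ⊕ Fin R → Prop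
  | Sum.inl (Sum.inr e'), Sum.inl (Sum.inl e) => N.inNode e' = N.outNode e
  | Sum.inr _, Sum.inl (Sum.inl e) => N.outNode e = S
  | Sum.inl (Sum.inr e'), Sum.inr _ => N.inNode e' = T
  | _, _ => False

open Classical in
/-- An assignment of the coding variables in an extension field that makes the system matrix
invertible can be replaced by one in the base field. -/
theorem exists_isUnit_systemMatrix_of_ringHom [Finite V] [Fintype I] [Fintype O]
    {N : ADTNetwork V I O} (hN : N.Acyclic) (S T : V) (f : K →+* L)
    (κ : CodingVariables I O L R) (hκ : IsUnit (N.systemMatrix S T κ)) :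
    ∃ κ' : CodingVariables I O K R, IsUnit (N.systemMatrix S T κ') := by
  rw [isUnit_systemMatrix_iff hN] at hκ
  obtain ⟨A, hdet, hout, hin⟩ := exists_det_ne_zero_entry_zero_or_one _ hκ
    (Finset.univ.filter fun p => N.IsCodingEntry S T p.1 p.2)
  replace hout : ∀ a b, ¬ N.IsCodingEntry S T a b → A a b = N.borderedMatrix S T κ a b :=
    fun a b h => hout (a, b) (by simpa using h)
  replace hin : ∀ a b, N.IsCodingEntry S T a b → A a b = 0 ∨ A a b = 1 :=
    fun a b h => hin (a, b) (by simpa using h)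
  let κ' : CodingVariables I O K R :=
    { α := fun i e => if A (Sum.inr i) (Sum.inl (Sum.inl e)) = 0 then 0 else 1
      -- The bordered matrix contains `1 - F`, so an entry `1` there means `β = -1`.
      β := fun e' e => if A (Sum.inl (Sum.inr e')) (Sum.inl (Sum.inl e)) = 0 then 0 else -1
      ε := fun e' k => if A (Sum.inl (Sum.inr e')) (Sum.inr k) = 0 then 0 else 1 }
  have hA : (N.borderedMatrix S T κ').map f = A := by
    ext a b
    by_cases h : N.IsCodingEntry S T a b
    · have h01 := hin a b h
      rcases a with (e | e') | i <;> rcases b with (o | i') | k <;>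
        simp only [IsCodingEntry] at h
      all_goals
        rcases h01 with h01 | h01 <;>
        simp [borderedMatrix, adjacencyMatrix, encodingMatrix, decodingMatrix, κ', h, h01]
    · rw [hout a b h]
      rcases a with (e | e') | i <;> rcases b with (o | i') | k <;>
        simp only [IsCodingEntry] at h <;>
        simp [borderedMatrix, adjacencyMatrix, encodingMatrix, decodingMatrix, h, one_apply,
          apply_ite f]
  refine ⟨κ', (isUnit_systemMatrix_iff hN S T κ').2 fun h0 => hdet ?_⟩
  rw [← hA]
  change (f.mapMatrix (N.borderedMatrix S T κ')).det = 0
  rw [← RingHom.map_det, h0, map_zero]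

open Classical in
theorem systemMatrix_eq_of_transfer [Finite V] [Fintype I] [Fintype O]
    {N : ADTNetwork V I O} (hN : N.Acyclic) (S T : V) (κ : CodingVariables I O K R)
    (hβ : ∀ i o, κ.β i o ≠ 0 → N.inNode i = N.outNode o) {G : Matrix O I K}
    (hG : G = N.edgeMatrix K + N.edgeMatrix K * of κ.β * G) :
    N.systemMatrix S T κ = of κ.α * (coordProj K (N.outNode ⁻¹' {S}) * G *
      coordProj K (N.inNode ⁻¹' {T})) * of κ.ε := by
  have hF : N.adjacencyMatrix κ = fromBlocks 0 (N.edgeMatrix K) (of κ.β) 0 := by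
    ext a b
    rcases a with e | e' <;> rcases b with o | i
    · rfl
    · rfl
    · by_cases h : N.inNode e' = N.outNode o
      · simp [adjacencyMatrix, h]
      · have : κ.β e' o = 0 := by_contra fun h' => h (hβ _ _ h')
        simp [adjacencyMatrix, this]
    · rfl
  have hA : N.encodingMatrix S κ =
      fromCols (of κ.α * coordProj K (N.outNode ⁻¹' {S})) 0 := by
    ext i a
    rcases a with e | e'
    · simp [encodingMatrix, coordProj, mul_diagonal, Set.indicator_apply]
    · rfl
  have hB : (N.decodingMatrix T κ)ᵀ =
      fromRows 0 (coordProj K (N.inNode ⁻¹' {T}) * of κ.ε) := by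
    ext a k
    rcases a with e | e'
    · rfl
    · simp [decodingMatrix, coordProj, diagonal_mul, Set.indicator_apply]
  have hu := (isUnit_iff_isUnit_det _).1 (isUnit_one_sub_adjacencyMatrix hN κ)
  obtain ⟨D, hD⟩ : ∃ D, D = coordProj K (N.inNode ⁻¹' {T}) * of κ.ε := ⟨_, rfl⟩
  -- `H` is the solution of `(1 - F) * H = Bᵀ`, written down from `G`, so that `1 - F` need not be
  -- inverted explicitly.
  obtain ⟨H, hH⟩ : ∃ H : Matrix (O ⊕ I) (Fin R) K,
      H = fromRows (G * D) (D + of κ.β * (G * D)) := ⟨_, rfl⟩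
  have hsolve : (1 - N.adjacencyMatrix κ) * H = (fromRows 0 D : Matrix (O ⊕ I) (Fin R) K) := by
    rw [hF, Matrix.sub_mul, Matrix.one_mul, hH, fromBlocks_mul_fromRows]
    have h1 : N.edgeMatrix K * (D + of κ.β * (G * D)) = G * D := by
      conv_rhs => rw [hG]
      simp only [Matrix.mul_add, Matrix.add_mul, Matrix.mul_assoc]
    rw [h1]
    ext a k
    rcases a with e | e' <;> simp
  rw [systemMatrix, hB, ← hD, Matrix.mul_assoc, ← hsolve,
    nonsing_inv_mul_cancel_left _ _ hu, hH, hA, fromCols_mul_fromRows, Matrix.zero_mul,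
    add_zero]
  simp only [hD, Matrix.mul_assoc]

open Classical in
-- The certificate `U * A * W = 1` for the rank survives a field extension, and further rows and
-- columns cannot lower the rank.
theorem le_rank_coordProj_mul_edgeMatrix [Fintype I] [Fintype O] (f : K →+* L)
    (N : ADTNetwork V I O) {Ω : Set V} (h : R ≤ (N.cutMatrix K Ω).rank) {x : Set O} {y : Set I}
    (hx : ∀ e, N.outNode e ∈ Ω → e ∈ x) (hy : ∀ e', N.inNode e' ∉ Ω → e' ∈ y) :
    R ≤ (coordProj L x * N.edgeMatrix L * coordProj L y).rank := by
  obtain ⟨U, W, hUW⟩ := exists_mul_mul_eq_one_of_le_rank _ h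
  have hmap : U.map f * (N.cutMatrix K Ω).map f * W.map f = 1 := by
    rw [← Matrix.map_mul, ← Matrix.map_mul, hUW, Matrix.map_one f (map_zero f) (map_one f)]
  have hsub : (N.cutMatrix K Ω).map f =
      (coordProj L x * N.edgeMatrix L * coordProj L y).submatrix Subtype.val Subtype.val := by
    ext e e'
    rw [submatrix_apply, coordProj_mul_mul_coordProj_apply,
      Set.indicator_of_mem (hx _ e.2), Set.indicator_of_mem (hy _ e'.2)]
    simp [cutMatrix, edgeMatrix, apply_ite f]
  refine (le_rank_of_mul_mul_eq_one hmap).trans ?_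
  rw [hsub]
  exact rank_submatrix_le _ _ _

open Classical in
theorem exists_isUnit_systemMatrix_of_le_rank_cutMatrix [Finite V] [Fintype I] [Fintype O]
    {N : ADTNetwork V I O} (hN : N.Acyclic) {S T : V} (hST : S ≠ T)
    (h : ∀ Ω : Set V, S ∈ Ω → T ∉ Ω → R ≤ (N.cutMatrix K Ω).rank) :
    ∃ κ : CodingVariables I O K R, IsUnit (N.systemMatrix S T κ) := by
  let := Fintype.ofFinite V
  let f := algebraMap K (AlgebraicClosure K)
  obtain ⟨ht, hht⟩ := hN.exists_height
  obtain ⟨B, G, hB, hG, hr⟩ := exists_transfer_of_le_rank_cut (r := R) N.outNode N.inNode ht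
    (S := S) (T := T) (Finset.univ \ {S, T}) (by simp) (by simp)
    (N.edgeMatrix (AlgebraicClosure K))
    (fun o i hoi => hht o i (by
      by_contra hne
      exact hoi (if_neg hne)))
    (fun a ha => by
      refine le_rank_coordProj_mul_edgeMatrix f N
        (h (insert S a : Finset V) (by simp) fun hT => ?_) (fun e he => he) fun e' he' => ?_
      · rcases Finset.mem_insert.1 (Finset.mem_coe.1 hT) with hT | hT
        · exact hST hT.symm
        · simpa using ha hT
      · simp only [Finset.mem_coe, Finset.mem_insert, not_or] at he'
        simp only [Set.mem_preimage, Finset.mem_coe, Finset.mem_insert, Finset.mem_sdiff,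
          Finset.mem_univ, true_and, Finset.mem_singleton]
        tauto)
  -- `U` serves as the encoder at `S` and `W` as the decoder at `T`.
  obtain ⟨U, W, hUW⟩ := exists_mul_mul_eq_one_of_le_rank _ hr
  refine exists_isUnit_systemMatrix_of_ringHom hN S T f ⟨U, B, W⟩ ?_
  have := systemMatrix_eq_of_transfer hN S T ⟨U, B, W⟩ hB hG
  rw [this]
  change IsUnit (U * _ * W)
  rw [hUW]
  exact isUnit_one

end ADTNetwork

theorem mainTheorem2 {V I O : Type*} [Finite V] [Fintype I] [Fintype O]
    (K : Type*) [Field K] [Finite K]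
    (N : ADTNetwork V I O) (hN : N.Acyclic) (S T : V) (hST : S ≠ T) (R : ℕ) :
    List.TFAE [
      N.Feasible K S T R,
      R ≤ N.minCut K S T,
      ∃ κ : CodingVariables I O K R, IsUnit (N.systemMatrix S T κ)] := by
  tfae_have 1 ↔ 3 := ADTNetwork.feasible_iff_exists_isUnit_systemMatrix hN S T
  tfae_have 1 → 2 := fun h =>
    (ADTNetwork.le_minCut_iff hST).2 fun _ hS hT => h.le_rank_cutMatrix hN hS hT
  tfae_have 2 → 3 := fun h =>
    ADTNetwork.exists_isUnit_systemMatrix_of_le_rank_cutMatrix hN hST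
      ((ADTNetwork.le_minCut_iff hST).1 h)
  tfae_finish
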